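/- Let $(R,\mathfrak m)$ be a Noetherian local ring of dimension $d>0$, let $Q$ be a parameter ideal of $R$ (an ideal generated by a system of parameters), and let $K$ be an ideal of $R$ with $Q\subseteq K$. For $n\gg 0$ the function $n\mapsto \ell(R/KQ^n)$ agrees with a polynomial, written $$P_K(Q,n)=\sum_{i=0}^{d}(-1)^i g_i(Q)\binom{n+d-i-1}{d-i}$$ with unique integers $g_i(Q)$, the Hilbert coefficients of $Q$ with respect to $K$. Let $(0)=\bigcap_{p\in \mathrm{Ass}(R)}Q(p)$ be a primary decomposition of $(0)$ in $R$ with $Q(p)$ $p$-primary, let $\mathrm{Assh}(R)=\{p\in \mathrm{Ass}(R): \dim R/p=d\}$, and let $U=U_R(0)=\bigcap_{p\in\mathrm{Assh}(R)}Q(p)$ be the unmixed component of $(0)$. Suppose $U\neq 0$ and put $S=R/U$; let $g_i(QS)$ denote the Hilbert coefficients of $QS$ with respect to $KS$ in the ring $S$, which likewise exist. Then: (a) $\dim U<\dim R$. (b) $g_0(Q)=g_0(QS)$, and $$g_1(Q)=\begin{cases} g_1(QS) & \text{if } \dim U\le d-2,\\ g_1(QS)-s_0 & \text{if } \dim U=d-1,\end{cases}$$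 where $s_0$ is the multiplicity of $\bigoplus_{n\ge 0}U/(KQ^{n+1}\cap U)$, i.e. the function $n\mapsto \ell(U/(KQ^{n+1}\cap U))$ agrees for $n\gg0$ with a nonzero polynomial, and $s_0$ is $t!$ times its leading coefficient, where $t$ is its degree. (c) $g_1(Q)\le g_1(QS)$, with equality if and only if $\dim U\le d-2$. -/

import Mathlib

/-- A parameter ideal of a local ring of dimension `d`: an ideal generated by a system of
parameters, i.e. generated by `d` elements and primary to the maximal ideal. -/
def IsParameterIdeal {R : Type*} [CommRing R] [IsLocalRing R] (Q : Ideal R) : Prop :=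
  ∃ (d : ℕ) (x : Fin d → R), ringKrullDim R = d ∧ Q = Ideal.span (Set.range x) ∧
    Q.radical = IsLocalRing.maximalIdeal R

/-- `Assh R`: the associated primes `p` of `R` with `dim R/p = dim R`. -/
def assh (R : Type*) [CommRing R] : Set (Ideal R) :=
  {p | p ∈ associatedPrimes R R ∧ ringKrullDim (R ⧸ p) = ringKrullDim R}

/-- `q` is a primary decomposition `(0) = ⋂ q p`, `p ∈ Ass R`, with `q p` being `p`-primary. -/
structure IsPrimaryDecompositionOfZero {R : Type*} [CommRing R] (q : Ideal R → Ideal R) :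
    Prop where
  isPrimary : ∀ p ∈ associatedPrimes R R, (q p).IsPrimary
  radical_eq : ∀ p ∈ associatedPrimes R R, (q p).radical = p
  iInf_eq : ⨅ p ∈ associatedPrimes R R, q p = ⊥

/-- `U` is the unmixed component `U_R(0) = ⋂ q p`, `p ∈ Assh R`, of `(0)` in `R`, where
`(0) = ⋂ q p`, `p ∈ Ass R`, is a primary decomposition. -/
def IsUnmixedComponent {R : Type*} [CommRing R] (U : Ideal R) : Prop :=
  ∃ q : Ideal R → Ideal R, IsPrimaryDecompositionOfZero q ∧ U = ⨅ p ∈ assh R, q p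

/-- In a Noetherian ring primary decompositions of `(0)` of the above shape exist. -/
theorem exists_isUnmixedComponent (R : Type*) [CommRing R] [IsNoetherianRing R] :
    ∃ U : Ideal R, IsUnmixedComponent U := by
  classical
  obtain ⟨t, ht⟩ := Submodule.IsLasker.exists_isMinimalPrimaryDecomposition
    (Submodule.isLasker R R) (⊥ : Submodule R R)
  have him := ht.image_radical_eq_associated_primes
  have hcol : ∀ J : Ideal R, (Submodule.colon J Set.univ) = J := fun J => by
    ext r
    rw [Submodule.mem_colon]
    exact ⟨fun h => by simpa using h 1 trivial, fun h x _ => J.mul_mem_right x h⟩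
  have hex : ∀ p : Ideal R, p ∈ associatedPrimes R R → ∃ J : Ideal R, J ∈ t ∧ J.radical = p := by
    intro p hp
    have hp' : p ∈ (⊥ : Submodule R R).associatedPrimes := hp
    rw [← him] at hp'
    obtain ⟨J, hJ, rfl⟩ := hp'
    exact ⟨J, hJ, by simp only [hcol J]⟩
  choose! q hqt hqr using hex
  refine ⟨_, q, ⟨fun p hp => ht.primary (hqt p hp), hqr, ?_⟩, rfl⟩
  rw [eq_bot_iff, ← ht.inf_eq]
  refine Finset.le_inf fun J hJ => ?_
  have hp : Ideal.radical J ∈ associatedPrimes R R := by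
    have := ht.mem_associatedPrimes hJ
    rwa [hcol J] at this
  have hJq : q (Ideal.radical J) = J := by
    refine ht.injOn _ _ (hqt _ hp) hJ ?_
    simp only [hcol J, hcol (q (Ideal.radical J)), hqr _ hp]
  exact (iInf₂_le _ hp).trans hJq.le

/-- `g` is the sequence of Hilbert coefficients of `Q` with respect to `K`: with `d = dim R`,
`ℓ(R/KQⁿ) = ∑_{i=0}^{d} (-1)^i g_i binom(n+d-i-1, d-i)` for all large `n`
(and, for definiteness, `g_i = 0` for `i > d`). -/
def HasHilbertCoeffs {R : Type*} [CommRing R] (Q K : Ideal R) (g : ℕ → ℤ) : Prop :=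
  ∃ d : ℕ, ringKrullDim R = d ∧ (∀ i, d < i → g i = 0) ∧
    ∀ᶠ n : ℕ in Filter.atTop, ∃ m : ℕ, Module.length R (R ⧸ (K * Q ^ n)) = m ∧
      (m : ℤ) = ∑ i ∈ Finset.range (d + 1),
        (-1) ^ i * g i * ((n + (d - i) - 1).choose (d - i) : ℤ)

/-- The polynomials `binom(n+k-1, k)` are linearly independent, even for large `n` only. -/
theorem coeff_eq_zero_of_sum_choose_eq_zero (D : ℕ) : ∀ (c : ℕ → ℤ) (N : ℕ),
    (∀ n, N ≤ n → ∑ k ∈ Finset.range (D + 1), c k * ((n + k - 1).choose k : ℤ) = 0) →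
    ∀ k, k ≤ D → c k = 0 := by
  induction D with
  | zero =>
    intro c N h k hk
    obtain rfl : k = 0 := by omega
    simpa using h N le_rfl
  | succ D ih =>
    intro c N h
    have key : ∀ k, k ≤ D → c (k + 1) = 0 := by
      refine ih (fun k => c (k + 1)) (N + 1) fun n hn => ?_
      obtain ⟨m, rfl⟩ : ∃ m, n = m + 1 := ⟨n - 1, by omega⟩
      have h1 := h (m + 1) (by omega)
      have h2 := h m (by omega)
      rw [Finset.sum_range_succ'] at h1 h2
      simp only [Nat.choose_zero_right] at h1 h2
      have h3 := sub_eq_zero.mpr (h1.trans h2.symm)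
      rw [add_sub_add_right_eq_sub, ← Finset.sum_sub_distrib] at h3
      rw [← h3]
      refine Finset.sum_congr rfl fun k _ => ?_
      have e1 : m + 1 + (k + 1) - 1 = (m + k) + 1 := by omega
      have e2 : m + (k + 1) - 1 = m + k := by omega
      have e3 : m + 1 + k - 1 = m + k := by omega
      rw [e1, e2, e3, Nat.choose_succ_succ]
      push_cast
      ring
    intro k hk
    rcases k with _ | k
    · have h1 := h N le_rfl
      rw [Finset.sum_range_succ', Finset.sum_eq_zero] at h1
      · simpa using h1
      · intro k hk
        rw [key k (by simpa [Nat.lt_succ_iff] using hk), zero_mul]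
    · exact key k (by omega)

/-- The Hilbert coefficients are unique. -/
theorem HasHilbertCoeffs.unique {R : Type*} [CommRing R] {Q K : Ideal R} {g h : ℕ → ℤ}
    (hg : HasHilbertCoeffs Q K g) (hh : HasHilbertCoeffs Q K h) : g = h := by
  obtain ⟨d, hd, hg0, hg⟩ := hg
  obtain ⟨d', hd', hh0, hh⟩ := hh
  obtain rfl : d = d' := by rw [hd] at hd'; exact_mod_cast hd'
  obtain ⟨N, hN⟩ := Filter.eventually_atTop.mp (hg.and hh)
  have key := coeff_eq_zero_of_sum_choose_eq_zero d
    (fun k => (-1) ^ (d - k) * (g (d - k) - h (d - k))) N (fun n hn => by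
      obtain ⟨⟨m, hm, hmg⟩, ⟨m', hm', hmh⟩⟩ := hN n hn
      obtain rfl : m = m' := by rw [hm] at hm'; exact_mod_cast hm'
      have h3 := sub_eq_zero.mpr (hmg.symm.trans hmh)
      rw [← Finset.sum_sub_distrib, ← Finset.sum_range_reflect] at h3
      rw [← h3]
      refine Finset.sum_congr rfl fun k hk => ?_
      have hk' : k ≤ d := by simpa [Nat.lt_succ_iff] using hk
      have e1 : d + 1 - 1 - k = d - k := by omega
      have e2 : d - (d - k) = k := by omega
      rw [e1, e2]
      ring)
  funext i
  rcases le_or_gt i d with hi | hi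
  · have := key (d - i) (by omega)
    simp only [Nat.sub_sub_self hi] at this
    rcases mul_eq_zero.mp this with h0 | h0
    · exact absurd h0 (pow_ne_zero _ (by norm_num))
    · exact sub_eq_zero.mp h0
  · rw [hg0 i hi, hh0 i hi]

open Classical in
/-- The Hilbert coefficient `g_i(Q)` of `Q` with respect to `K` (`0` if there are none). -/
noncomputable def hilbertCoeff {R : Type*} [CommRing R] (Q K : Ideal R) (i : ℕ) : ℤ :=
  if h : ∃ g : ℕ → ℤ, HasHilbertCoeffs Q K g then h.choose i else 0

/-- `s` is the multiplicity of the graded `R`-module `⨁ M n`: each `M n` with `n` large has finite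
length, `n ↦ ℓ(M n)` agrees for large `n` with a nonzero polynomial `P`, and `s` is the normalized
leading coefficient of `P`, i.e. `P(n) = s binom(n+t, t) + (terms of degree < t)` with
`t = deg P`. -/
def HasMultiplicity (R : Type*) [CommRing R] (M : ℕ → Type*) [∀ n, AddCommGroup (M n)]
    [∀ n, Module R (M n)] (s : ℤ) : Prop :=
  ∃ P : Polynomial ℚ, P ≠ 0 ∧
    (∀ᶠ n : ℕ in Filter.atTop, ∃ m : ℕ, Module.length R (M n) = m ∧ P.eval (n : ℚ) = m) ∧
    (s : ℚ) = (P.natDegree.factorial : ℚ) * P.leadingCoeff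

/-! The sequence `0 → U/(KQⁿ ∩ U) → R/KQⁿ → S/KQⁿS → 0` is exact, and `dim S = d` since `U` lies in
every prime of `Assh R`. So the two Hilbert polynomials are written in the same basis, and their
difference is the function `ℓ(U/(KQⁿ ∩ U))`. Its coefficients in degrees `d` and `d-1` are `g₀(Q) -
g₀(QS)` and `g₁(QS) - g₁(Q)`.

This function grows exactly like `n ^ t` with `t = dim U`. It grows at most that fast because `Qⁿ⁺¹
⊆ KQⁿ` and `U` is generated by finitely many elements killed by `Ann U` (`exists_relLength_le`). It
grows at least that fast because `U` contains a copy of some `R/p` of dimension at least `t`, and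
Artin-Rees compares the two filtrations on it (`exists_choose_le_relLength`). Moreover `t < d`, as
`Ann U` lies in no prime of `Assh R` (`IsUnmixedComponent.not_annihilator_le`). Hence the
coefficient in degree `d` vanishes, and the one in degree `d-1` is zero if `t < d-1` and positive,
equal to `s₀`, if `t = d-1`.

The Hilbert coefficients exist because Hilbert functions of graded modules over the Rees algebra are
eventually polynomial (`eventuallyPolynomial_relLength`). -/

/-! ### Eventually polynomial functions. -/

/-- `f` agrees for large `n` with a polynomial of degree `< k`: its `k`-th difference function
vanishes for large `n`. -/
def EventuallyPolynomial : ℕ → (ℕ → ℤ) → Prop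
  | 0, f => ∀ᶠ n in Filter.atTop, f n = 0
  | k + 1, f => EventuallyPolynomial k fun n => f (n + 1) - f n

namespace EventuallyPolynomial

theorem congr {k : ℕ} : ∀ {f g : ℕ → ℤ}, EventuallyPolynomial k f →
    (∀ᶠ n in Filter.atTop, f n = g n) → EventuallyPolynomial k g := by
  induction k with
  | zero =>
    intro f g hf h
    exact (hf.and h).mono fun n hn => hn.2 ▸ hn.1
  | succ k ih =>
    intro f g hf h
    refine ih (f := fun n => f (n + 1) - f n) hf ?_
    filter_upwards [h, (Filter.tendsto_add_atTop_nat 1).eventually h] with n h1 h2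
    rw [h1, h2]

theorem sub {k : ℕ} : ∀ {f g : ℕ → ℤ}, EventuallyPolynomial k f →
    EventuallyPolynomial k g → EventuallyPolynomial k fun n => f n - g n := by
  induction k with
  | zero =>
    intro f g hf hg
    exact (hf.and hg).mono fun n hn => by simp [hn.1, hn.2]
  | succ k ih =>
    intro f g hf hg
    refine (ih (f := fun n => f (n + 1) - f n) (g := fun n => g (n + 1) - g n) hf hg).congr ?_
    filter_upwards with n
    ring

theorem comp_succ_iff {k : ℕ} : ∀ {f : ℕ → ℤ},
    EventuallyPolynomial k (fun n => f (n + 1)) ↔ EventuallyPolynomial k f := by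
  induction k with
  | zero =>
    intro f
    refine ⟨fun h => ?_, fun h => (Filter.tendsto_add_atTop_nat 1).eventually h⟩
    obtain ⟨N, hN⟩ := Filter.eventually_atTop.mp h
    refine Filter.eventually_atTop.mpr ⟨N + 1, fun n hn => ?_⟩
    obtain ⟨m, rfl⟩ : ∃ m, n = m + 1 := ⟨n - 1, by omega⟩
    exact hN m (by omega)
  | succ k ih =>
    intro f
    exact ih (f := fun n => f (n + 1) - f n)

/-- An eventually polynomial function is eventually an integral combination of the functions
`binom(n+j-1, j)`. -/
theorem exists_eq_sum_choose {k : ℕ} : ∀ {f : ℕ → ℤ}, EventuallyPolynomial k f →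
    ∃ c : ℕ → ℤ, ∀ᶠ n in Filter.atTop,
      f n = ∑ j ∈ Finset.range k, c j * ((n + j - 1).choose j : ℤ) := by
  induction k with
  | zero =>
    intro f hf
    exact ⟨0, by simpa [EventuallyPolynomial] using hf⟩
  | succ k ih =>
    intro f hf
    -- Backward differences fit the basis: that of `binom(n+j, j+1)` is `binom(n+j-1, j)`, so `f` is
    -- recovered by raising each index by one and adding a constant.
    have hf' : EventuallyPolynomial k fun n => f n - f (n - 1) := by
      rw [← comp_succ_iff]
      exact hf
    obtain ⟨c, hc⟩ := ih hf'
    obtain ⟨N, hN⟩ := Filter.eventually_atTop.mp hc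
    let F : ℕ → ℤ := fun n => ∑ j ∈ Finset.range k, c j * ((n + (j + 1) - 1).choose (j + 1) : ℤ)
    have hF : ∀ n, N ≤ n → f n - F n = f N - F N := by
      intro n hn
      induction n, hn using Nat.le_induction with
      | base => rfl
      | succ n hn ihn =>
        rw [← ihn]
        have h1 : f (n + 1) - f n = F (n + 1) - F n := by
          have := hN (n + 1) (by omega)
          simp only [Nat.add_sub_cancel] at this
          rw [this, ← Finset.sum_sub_distrib]
          refine Finset.sum_congr rfl fun j _ => ?_
          have e1 : n + 1 + (j + 1) - 1 = (n + j) + 1 := by omega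
          have e2 : n + (j + 1) - 1 = n + j := by omega
          have e3 : n + 1 + j - 1 = n + j := by omega
          rw [e1, e2, e3, Nat.choose_succ_succ]
          push_cast
          ring
        linarith
    refine ⟨fun j => if j = 0 then f N - F N else c (j - 1), ?_⟩
    filter_upwards [Filter.eventually_ge_atTop N] with n hn
    rw [Finset.sum_range_succ']
    simp only [Nat.add_eq_zero_iff, one_ne_zero, and_false, if_false, Nat.add_sub_cancel, if_true,
      Nat.choose_zero_right, Nat.cast_one, mul_one]
    linarith [hF n hn]

end EventuallyPolynomial

/-! ### Relative lengths of submodules. -/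

/-- The length of `(a + b) / b`. -/
noncomputable def relLength {R M : Type*} [CommRing R] [AddCommGroup M] [Module R M]
    (b a : Submodule R M) : ℕ∞ :=
  Module.length R (a ⧸ b.comap a.subtype)

section relLength

variable {R M N : Type*} [CommRing R] [AddCommGroup M] [Module R M] [AddCommGroup N] [Module R N]

/-- The composite `a → f(a) → f(a)/(f(a) ∩ b)` is onto with kernel `a ∩ f⁻¹(b)`. -/
theorem relLength_map (f : M →ₗ[R] N) (a : Submodule R M) (b : Submodule R N) :
    relLength b (a.map f) = relLength (b.comap f) a := by
  let g : a →ₗ[R] (a.map f ⧸ b.comap (a.map f).subtype) :=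
    (b.comap (a.map f).subtype).mkQ ∘ₗ f.submoduleMap a
  have hg : Function.Surjective g :=
    (Submodule.mkQ_surjective _).comp (f.submoduleMap_surjective a)
  have hk : LinearMap.ker g = (b.comap f).comap a.subtype := by
    ext y
    simp [g, Submodule.Quotient.mk_eq_zero]
  rw [relLength, relLength, ← hk]
  exact (g.quotKerEquivOfSurjective hg).length_eq.symm

theorem relLength_inf_right (b a : Submodule R M) : relLength (a ⊓ b) a = relLength b a := by
  rw [relLength, relLength]
  congr 2 <;> simp [Submodule.comap_inf]

theorem relLength_sup_right (b a : Submodule R M) : relLength b (a ⊔ b) = relLength b a := by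
  rw [relLength, ← relLength_inf_right, relLength]
  exact (LinearMap.quotientInfEquivSupQuotient a b).length_eq.symm

theorem relLength_eq_add {a b c : Submodule R M} (hbc : b ≤ c) (hca : c ≤ a) :
    relLength b a = relLength b c + relLength c a := by
  have hmem : b.comap c.subtype = (b.comap a.subtype).comap (Submodule.inclusion hca) := rfl
  let f : (c ⧸ b.comap c.subtype) →ₗ[R] (a ⧸ b.comap a.subtype) :=
    Submodule.mapQ _ _ (Submodule.inclusion hca) hmem.le
  let g : (a ⧸ b.comap a.subtype) →ₗ[R] (a ⧸ c.comap a.subtype) :=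
    Submodule.factor (Submodule.comap_mono hbc)
  refine Module.length_eq_add_of_exact f g ?_ (Submodule.factor_surjective _) ?_
  · rw [← LinearMap.ker_eq_bot, Submodule.ker_mapQ, ← hmem, Submodule.mkQ_map_self]
  · rw [LinearMap.exact_iff]
    ext y
    obtain ⟨y, rfl⟩ := Submodule.mkQ_surjective _ y
    simp only [LinearMap.mem_ker, LinearMap.mem_range]
    constructor
    · intro h
      have h' : (y : M) ∈ c := by simpa [g, Submodule.Quotient.mk_eq_zero] using h
      exact ⟨Submodule.Quotient.mk ⟨y, h'⟩, rfl⟩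
    · rintro ⟨z, hz⟩
      obtain ⟨z, rfl⟩ := Submodule.mkQ_surjective _ z
      rw [← hz]
      simp [f, g, Submodule.Quotient.mk_eq_zero]

theorem relLength_eq_zero {a b : Submodule R M} (h : a ≤ b) : relLength b a = 0 := by
  rw [relLength, Module.length_eq_zero_iff, Submodule.Quotient.subsingleton_iff,
    eq_top_iff]
  exact fun y _ => h y.2

theorem relLength_top (b : Submodule R M) : relLength b ⊤ = Module.length R (M ⧸ b) := by
  have := relLength_map (⊤ : Submodule R M).subtype ⊤ b
  rw [Submodule.map_subtype_top] at this
  refine LinearEquiv.length_eq (Submodule.Quotient.equiv _ _ Submodule.topEquiv ?_)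
  ext y
  simp

theorem relLength_mono_right {a a' : Submodule R M} (b : Submodule R M) (h : a' ≤ a) :
    relLength b a' ≤ relLength b a := by
  rw [← relLength_sup_right b a, ← relLength_sup_right b a',
    relLength_eq_add le_sup_right (sup_le_sup_right h b)]
  exact le_self_add

theorem relLength_anti_left {b b' : Submodule R M} (a : Submodule R M) (h : b' ≤ b) :
    relLength b a ≤ relLength b' a :=
  Module.length_le_of_surjective _ (Submodule.factor_surjective (Submodule.comap_mono h))

end relLength

/-! ### Hilbert functions over the Rees algebra. -/

section ReesSequences

variable {R : Type*} [CommRing R] {Q : Ideal R} {a : ℕ → Ideal R}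

theorem pow_add_mul_le (h : ∀ n, Q * a n ≤ a (n + 1)) (k e i : ℕ) :
    Q ^ (k + e) * a i ≤ Q ^ e * a (i + k) := by
  induction k with
  | zero => simp
  | succ k ih =>
    calc Q ^ (k + 1 + e) * a i = Q * (Q ^ (k + e) * a i) := by rw [← mul_assoc, ← pow_succ']; ring_nf
      _ ≤ Q * (Q ^ e * a (i + k)) := Ideal.mul_mono_right ih
      _ = Q ^ e * (Q * a (i + k)) := by ring
      _ ≤ Q ^ e * a (i + (k + 1)) := Ideal.mul_mono_right (h _)

/-- The ideal of the Rees algebra of `Q` that a sequence of ideals `J n` with `Q ^ j * J i ⊆ J (i+j)`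
defines. -/
def reesIdeal (Q : Ideal R) (J : ℕ → Ideal R) (h : ∀ i j, Q ^ j * J i ≤ J (i + j)) :
    Ideal (reesAlgebra Q) where
  carrier := {f | ∀ i, (f : Polynomial R).coeff i ∈ J i}
  add_mem' hf hg i := by
    simpa using (J i).add_mem (hf i) (hg i)
  zero_mem' i := by simp
  smul_mem' r f hf i := by
    change ((r : Polynomial R) * (f : Polynomial R)).coeff i ∈ J i
    rw [Polynomial.coeff_mul]
    refine Submodule.sum_mem _ ?_
    rintro ⟨j, k⟩ e
    rw [Finset.HasAntidiagonal.mem_antidiagonal] at e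
    subst e
    have := h k j (Ideal.mul_mem_mul (r.2 j) (hf k))
    rwa [add_comm k j] at this

/-- A graded ideal of the Rees algebra of `Q` is generated in bounded degrees. -/
theorem exists_forall_le_mul [IsNoetherianRing R] (ha : ∀ n, a n ≤ Q ^ n)
    (h : ∀ n, Q * a n ≤ a (n + 1)) : ∃ m, ∀ n ≥ m, a (n + 1) ≤ Q * a n := by
  -- `J m i` is the degree `i` part of the ideal generated by the components `a 0, …, a m`. These
  -- ideals ascend with `m`, so they stabilize; comparing `J n` and `J (n+1)` in degree `n+1` gives
  -- the claim.
  let J : ℕ → ℕ → Ideal R := fun m i => Q ^ (i - m) * a (min i m)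
  have hJ : ∀ m i j, Q ^ j * J m i ≤ J m (i + j) := by
    intro m i j
    obtain ⟨k, hk, hk'⟩ : ∃ k, min (i + j) m = min i m + k ∧ k + (i + j - m) = j + (i - m) :=
      ⟨min (i + j) m - min i m, by omega, by omega⟩
    change Q ^ j * (Q ^ (i - m) * _) ≤ Q ^ (i + j - m) * a (min (i + j) m)
    rw [← mul_assoc, ← pow_add, ← hk', hk]
    exact pow_add_mul_le h _ _ _
  have hmono : ∀ m i, J m i ≤ J (m + 1) i := by
    intro m i
    obtain ⟨k, hk, hk'⟩ : ∃ k, min i (m + 1) = min i m + k ∧ k + (i - (m + 1)) = i - m :=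
      ⟨min i (m + 1) - min i m, by omega, by omega⟩
    change Q ^ (i - m) * _ ≤ Q ^ (i - (m + 1)) * a (min i (m + 1))
    rw [← hk', hk]
    exact pow_add_mul_le h _ _ _
  let A : ℕ →o Ideal (reesAlgebra Q) :=
    ⟨fun m => reesIdeal Q (J m) (hJ m), monotone_nat_of_le_succ fun m f hf i => hmono m i (hf i)⟩
  obtain ⟨m, hm⟩ := monotone_stabilizes_iff_noetherian.mpr
    (inferInstance : IsNoetherian (reesAlgebra Q) (reesAlgebra Q)) A
  refine ⟨m, fun n hn r hr => ?_⟩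
  have hr' : (⟨Polynomial.monomial (n + 1) r, reesAlgebra.monomial_mem.mpr (ha _ hr)⟩ :
      reesAlgebra Q) ∈ A (n + 1) := by
    intro i
    change (Polynomial.monomial (n + 1) r).coeff i ∈ J (n + 1) i
    rw [Polynomial.coeff_monomial]
    split_ifs with hi
    · subst hi
      simpa [J] using hr
    · exact zero_mem _
  rw [← hm (n + 1) (by omega), hm n hn] at hr'
  have := hr' (n + 1)
  simpa [J] using this

theorem exists_toNat_add_eq {p q r s : ℕ∞} (h : p + q = r + s) (hp : p ≠ ⊤) (hq : q ≠ ⊤)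
    (hr : r ≠ ⊤) (hs : s ≠ ⊤) : (p.toNat : ℤ) - r.toNat = s.toNat - q.toNat := by
  lift p to ℕ using hp
  lift q to ℕ using hq
  lift r to ℕ using hr
  lift s to ℕ using hs
  have : p + q = r + s := by exact_mod_cast h
  simp only [ENat.toNat_natCast]
  omega

/-- The Hilbert function of a finitely generated graded module `⨁ a n / b n` over the Rees algebra
of `Q`, killed by all but `k` of the given generators `x i` of `Q` (placed in degree one),
is eventually a polynomial of degree `< k`. -/
theorem eventuallyPolynomial_relLength [IsNoetherianRing R] {x : ℕ → R}
    (hx : Q = Ideal.span (Set.range x)) (k : ℕ) : ∀ {a b : ℕ → Ideal R},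
    (∀ n, a n ≤ Q ^ n) → (∀ n, b n ≤ a n) → (∀ n, Q * a n ≤ a (n + 1)) →
    (∀ n, Q * b n ≤ b (n + 1)) → (∀ i, k ≤ i → ∀ n, ∀ r ∈ a n, x i * r ∈ b (n + 1)) →
    (∀ n, relLength (b n) (a n) ≠ ⊤) →
    EventuallyPolynomial k fun n => ((relLength (b n) (a n)).toNat : ℤ) := by
  induction k with
  | zero =>
    intro a b ha hba hQa hQb hk hfin
    obtain ⟨m, hm⟩ := exists_forall_le_mul ha hQa
    refine Filter.eventually_atTop.mpr ⟨m + 1, fun n hn => ?_⟩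
    obtain ⟨n, rfl⟩ : ∃ m, n = m + 1 := ⟨n - 1, by omega⟩
    -- Every generator of `Q` kills `a/b`, and `a` is eventually generated from the previous degree,
    -- so `a/b` vanishes in large degrees.
    have hle : a (n + 1) ≤ b (n + 1) := by
      refine (hm n (by omega)).trans ?_
      rw [Ideal.mul_le]
      intro q hq r hr
      rw [hx] at hq
      induction hq using Submodule.span_induction with
      | mem y hy =>
        obtain ⟨i, rfl⟩ := hy
        exact hk i (Nat.zero_le i) n r hr
      | zero => simp
      | add y z _ _ h1 h2 => rw [add_mul]; exact add_mem h1 h2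
      | smul c y _ h1 => rw [smul_mul_assoc]; exact Submodule.smul_mem _ c h1
    simp [relLength_eq_zero hle]
  | succ k ih =>
    intro a b ha hba hQa hQb hk hfin
    have hxQ : x k ∈ Q := hx ▸ Ideal.subset_span ⟨k, rfl⟩
    let f : R →ₗ[R] R := LinearMap.mulLeft R (x k)
    -- `K/b` is the kernel and `a/c` the cokernel of multiplication by `x k` on `⨁ a n / b n`; both
    -- are also killed by `x k`. In degree `0` nothing is hit, hence `c 0 = b 0`.
    let K : ℕ → Ideal R := fun n => a n ⊓ Submodule.comap f (b (n + 1))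
    let c : ℕ → Ideal R := fun n => Nat.casesOn n (b 0) fun n => Submodule.map f (a n) ⊔ b (n + 1)
    have hmap : ∀ n, Submodule.map f (a n) ≤ a (n + 1) := by
      rintro n _ ⟨r, hr, rfl⟩
      exact hQa n (Ideal.mul_mem_mul hxQ hr)
    have hbK : ∀ n, b n ≤ K n := fun n =>
      le_inf (hba n) fun r hr => hQb n (Ideal.mul_mem_mul hxQ hr)
    have hKa : ∀ n, K n ≤ a n := fun n => inf_le_left
    have hbc : ∀ n, b n ≤ c n := by
      rintro (_ | n)
      · exact le_rfl
      · exact le_sup_right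
    have hca : ∀ n, c n ≤ a n := by
      rintro (_ | n)
      · exact hba 0
      · exact sup_le (hmap n) (hba _)
    have hfinK : ∀ n, relLength (b n) (K n) ≠ ⊤ := fun n =>
      ne_top_of_le_ne_top (hfin n) (relLength_mono_right _ (hKa n))
    have hfinc : ∀ n, relLength (c n) (a n) ≠ ⊤ := fun n =>
      ne_top_of_le_ne_top (hfin n) (relLength_anti_left _ (hbc n))
    have hK := ih (a := K) (b := b) (fun n => (hKa n).trans (ha n)) hbK
      (fun n => by
        rw [Ideal.mul_le]
        intro q hq r hr
        refine ⟨hQa n (Ideal.mul_mem_mul hq hr.1), ?_⟩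
        have := hQb _ (Ideal.mul_mem_mul hq hr.2)
        change x k * (q * r) ∈ b (n + 1 + 1)
        rwa [mul_left_comm]) hQb
      (fun i hi n r hr => by
        rcases hi.eq_or_lt with rfl | hi
        · exact hr.2
        · exact hk i hi n r hr.1) hfinK
    have hc := ih (a := a) (b := c) ha hca hQa
      (fun n => by
        rcases n with _ | n
        · exact (hQb 0).trans (hbc 1)
        · change Q * (Submodule.map f (a n) ⊔ b (n + 1)) ≤ Submodule.map f (a (n + 1)) ⊔ b (n + 2)
          rw [Ideal.mul_sup]
          refine sup_le_sup ?_ (hQb _)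
          rw [Ideal.mul_le]
          rintro q hq _ ⟨r, hr, rfl⟩
          exact ⟨q * r, hQa n (Ideal.mul_mem_mul hq hr), mul_left_comm _ _ _⟩)
      (fun i hi n r hr => by
        rcases hi.eq_or_lt with rfl | hi
        · exact Submodule.mem_sup_left ⟨r, hr, rfl⟩
        · exact hbc _ (hk i hi n r hr)) hfinc
    rw [← EventuallyPolynomial.comp_succ_iff] at hc
    -- The first difference of the Hilbert function is the cokernel length in degree `n+1` minus the
    -- kernel length in degree `n`.
    refine (hc.sub hK).congr (Filter.Eventually.of_forall fun n => ?_)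
    refine (exists_toNat_add_eq ?_ (hfin _) (hfinK _) (hfin _) (hfinc _)).symm
    have h1 := relLength_eq_add (hbc (n + 1)) (hca (n + 1))
    have h2 := relLength_eq_add (hbK n) (hKa n)
    have h3 : relLength (b (n + 1)) (c (n + 1)) = relLength (K n) (a n) := by
      change relLength (b (n + 1)) (Submodule.map f (a n) ⊔ b (n + 1)) = relLength (a n ⊓ Submodule.comap f (b (n + 1))) (a n)
      rw [relLength_sup_right, relLength_map, ← relLength_inf_right]
    rw [h1, h2, h3]
    ring

end ReesSequences

/-! ### Existence of the Hilbert coefficients. -/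

section HilbertCoefficients

variable {R : Type*} [CommRing R]

/-- The first difference is the Hilbert function of `⨁ KQⁿ/KQⁿ⁺¹`, on which only `d` generators of
`Q` can act nontrivially. -/
theorem eventuallyPolynomial_length_quotient [IsNoetherianRing R] {d : ℕ} (x : Fin d → R)
    {Q : Ideal R} (hx : Q = Ideal.span (Set.range x)) (K : Ideal R)
    (hfin : ∀ n, Module.length R (R ⧸ K * Q ^ n) ≠ ⊤) :
    EventuallyPolynomial (d + 1) fun n => ((Module.length R (R ⧸ K * Q ^ n)).toNat : ℤ) := by
  -- Padding by zeros makes all generators of index at least `d` act as zero.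
  let y : ℕ → R := fun i => if h : i < d then x ⟨i, h⟩ else 0
  have hy : Q = Ideal.span (Set.range y) := by
    rw [hx]
    refine le_antisymm (Ideal.span_mono ?_) (Ideal.span_le.mpr ?_)
    · rintro _ ⟨i, rfl⟩
      exact ⟨i, by simp [y]⟩
    · rintro _ ⟨i, rfl⟩
      by_cases hi : i < d
      · exact Ideal.subset_span ⟨⟨i, hi⟩, by simp [y, hi]⟩
      · simp [y, hi]
  have hle : ∀ n, K * Q ^ (n + 1) ≤ K * Q ^ n := fun n =>
    Ideal.mul_mono_right (Ideal.pow_le_pow_right n.le_succ)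
  have hsucc : ∀ n, Module.length R (R ⧸ K * Q ^ (n + 1)) =
      relLength (K * Q ^ (n + 1)) (K * Q ^ n) + Module.length R (R ⧸ K * Q ^ n) := by
    intro n
    rw [← relLength_top, ← relLength_top]
    exact relLength_eq_add (hle n) le_top
  have hrel : ∀ n, relLength (K * Q ^ (n + 1)) (K * Q ^ n) ≠ ⊤ := fun n =>
    ne_top_of_le_ne_top (hfin (n + 1)) (hsucc n ▸ le_self_add)
  have hmul : ∀ n, Q * (K * Q ^ n) ≤ K * Q ^ (n + 1) := fun n => by
    rw [pow_succ', mul_left_comm]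
  have key := eventuallyPolynomial_relLength hy d (a := fun n => K * Q ^ n)
    (b := fun n => K * Q ^ (n + 1)) (fun n => Ideal.mul_le_right) hle hmul (fun n => hmul (n + 1))
    (fun i hi n r _ => by simp [y, hi.not_gt]) hrel
  refine EventuallyPolynomial.congr (k := d) key (Filter.Eventually.of_forall fun n => ?_)
  beta_reduce
  rw [hsucc n, ENat.toNat_add (hrel n) (hfin n)]
  push_cast
  ring

theorem HasHilbertCoeffs.of_eventuallyPolynomial {d : ℕ} (hd : ringKrullDim R = d) {Q K : Ideal R}
    (hfin : ∀ n, Module.length R (R ⧸ K * Q ^ n) ≠ ⊤)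
    (h : EventuallyPolynomial (d + 1) fun n => ((Module.length R (R ⧸ K * Q ^ n)).toNat : ℤ)) :
    ∃ g : ℕ → ℤ, HasHilbertCoeffs Q K g := by
  obtain ⟨c, hc⟩ := h.exists_eq_sum_choose
  refine ⟨fun i => if i ≤ d then (-1) ^ i * c (d - i) else 0, d, hd, fun i hi => ?_, ?_⟩
  · simp [hi.not_ge]
  · filter_upwards [hc] with n hn
    refine ⟨_, (ENat.natCast_toNat (hfin n)).symm, ?_⟩
    rw [hn, ← Finset.sum_range_reflect]
    refine Finset.sum_congr rfl fun i hi => ?_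
    have hi' : i ≤ d := by simpa [Nat.lt_succ_iff] using hi
    simp only [hi', if_true, Nat.add_sub_cancel, ← mul_assoc, ← mul_pow]
    simp

theorem hasHilbertCoeffs_hilbertCoeff {Q K : Ideal R} (h : ∃ g : ℕ → ℤ, HasHilbertCoeffs Q K g) :
    HasHilbertCoeffs Q K (hilbertCoeff Q K) := by
  have : hilbertCoeff Q K = h.choose := by
    funext i
    simp [hilbertCoeff, h]
  exact this ▸ h.choose_spec

/-- Quotients by ideals containing a power of an ideal with maximal radical have finite length. -/
theorem length_quotient_ne_top [IsNoetherianRing R] {Q J : Ideal R} (hQ : Q.radical.IsMaximal)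
    {n : ℕ} (h : Q ^ n ≤ J) : Module.length R (R ⧸ J) ≠ ⊤ := by
  have : Ring.KrullDimLE 0 (R ⧸ J) := by
    rw [Ideal.krullDimLE_zero_quotient_iff_forall_minimalPrimes_isMaximal]
    intro p hp
    have hprime := hp.1.1
    have hQp : Q.radical ≤ p :=
      hprime.radical_le_iff.mpr (Ideal.IsPrime.le_of_pow_le (h.trans hp.1.2))
    rwa [← hQ.eq_of_le hprime.ne_top hQp]
  have : IsArtinianRing (R ⧸ J) := IsNoetherianRing.isArtinianRing_of_krullDimLE_zero
  rw [Module.length_eq_of_surjective (R := R ⧸ J) (S := R) (M := R ⧸ J)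
    (Ideal.Quotient.mk_surjective)]
  exact Module.length_ne_top

theorem length_quotient_map_mk (U J : Ideal R) :
    Module.length (R ⧸ U) ((R ⧸ U) ⧸ J.map (Ideal.Quotient.mk U)) =
      Module.length R (R ⧸ U ⊔ J) := by
  rw [← Module.length_eq_of_surjective (R := R ⧸ U) (S := R) (Ideal.Quotient.mk_surjective)]
  exact (DoubleQuot.quotQuotEquivQuotSupₐ R U J).toLinearEquiv.length_eq

/-- Additivity along `0 → U/(U ∩ J) → R/J → R/(U+J) → 0`, the source of the comparison between `R`
and `S`. -/
theorem length_quotient_eq_add_relLength (U J : Ideal R) :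
    Module.length R (R ⧸ J) = relLength J U + Module.length R (R ⧸ U ⊔ J) := by
  rw [← relLength_top, ← relLength_top, ← relLength_sup_right J U]
  exact relLength_eq_add le_sup_right le_top

end HilbertCoefficients

/-! ### Growth of `ℓ(R/(I + Qⁿ))` in terms of dimension. -/

section Growth

variable {R : Type*} [CommRing R]

theorem length_quotient_mono {I J : Ideal R} (h : I ≤ J) :
    Module.length R (R ⧸ J) ≤ Module.length R (R ⧸ I) :=
  Module.length_le_of_surjective _ (Submodule.factor_surjective h)

theorem WithBot.le_natCast_of_add_one_le {a : WithBot ℕ∞} {t : ℕ}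
    (h : a + 1 ≤ (t : WithBot ℕ∞) + 1) : a ≤ t := by
  cases a with
  | bot => exact bot_le
  | coe a =>
    have h' : a + 1 ≤ (t : ℕ∞) + 1 := by exact_mod_cast h
    have h'' : a ≤ (t : ℕ∞) := (WithTop.add_le_add_iff_right ENat.one_ne_top).mp h'
    exact_mod_cast h''

theorem relLength_span_singleton (J : Ideal R) (y : R) :
    relLength J (Ideal.span {y}) =
      Module.length R (R ⧸ Submodule.comap (LinearMap.mulLeft R y) J) := by
  rw [← relLength_top, ← relLength_map]
  congr 1
  ext z
  simp [Ideal.mem_span_singleton', mul_comm]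

/-- Multiplication by `y` identifies `R/(J : y)` with `((y) + J)/J`. Both growth bounds are
inductions on this formula. -/
theorem length_quotient_eq_add (J : Ideal R) (y : R) :
    Module.length R (R ⧸ J) = Module.length R (R ⧸ Submodule.comap (LinearMap.mulLeft R y) J) +
      Module.length R (R ⧸ Ideal.span {y} ⊔ J) := by
  rw [← relLength_span_singleton]
  exact length_quotient_eq_add_relLength _ _

open scoped Pointwise in
theorem ringKrullDim_quotient_sup_span_singleton_succ_le {I : Ideal R} {y : R}
    (hy : ∀ p ∈ I.minimalPrimes, y ∉ p) :
    ringKrullDim (R ⧸ I ⊔ Ideal.span {y}) + 1 ≤ ringKrullDim (R ⧸ I) := by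
  have h := Module.supportDim_quotSMulTop_succ_le_of_notMem_minimalPrimes (R := R) (M := R ⧸ I)
    (x := y) (by rwa [Ideal.annihilator_quotient])
  have e : y • (⊤ : Submodule R (R ⧸ I)) = Submodule.map I.mkQ (Ideal.span {y}) := by
    ext z
    obtain ⟨z, rfl⟩ := Submodule.mkQ_surjective _ z
    simp only [Submodule.mem_smul_pointwise_iff_exists, Submodule.mem_top, true_and,
      Submodule.mem_map, Ideal.mem_span_singleton']
    constructor
    · rintro ⟨w, hw⟩
      obtain ⟨w, rfl⟩ := Submodule.mkQ_surjective _ w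
      exact ⟨w * y, ⟨w, rfl⟩, by rw [← hw, mul_comm w y, ← smul_eq_mul, map_smul]⟩
    · rintro ⟨_, ⟨w, rfl⟩, hw⟩
      exact ⟨I.mkQ w, by rw [← hw, mul_comm w y, ← smul_eq_mul y w, map_smul]⟩
  rw [← Module.supportDim_quotient_eq_ringKrullDim, ← Module.supportDim_quotient_eq_ringKrullDim,
    ← Module.supportDim_eq_of_equiv (Submodule.quotientQuotientEquivQuotientSup I (Ideal.span {y})),
    ← Module.supportDim_eq_of_equiv (Submodule.quotEquivOfEq _ _ e)]
  exact h

/-- Prime avoidance for the finitely many minimal primes of `I`. -/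
theorem exists_mem_forall_minimalPrimes_notMem [IsNoetherianRing R] {Q I : Ideal R}
    (h : ∀ p ∈ I.minimalPrimes, ¬ Q ≤ p) : ∃ y ∈ Q, ∀ p ∈ I.minimalPrimes, y ∉ p := by
  by_contra! hcon
  have hsub : (Q : Set R) ⊆
      ⋃ p ∈ (↑(Ideal.finite_minimalPrimes_of_isNoetherianRing R I).toFinset : Set (Ideal R)),
        (p : Set R) := by
    intro y hy
    obtain ⟨p, hp, hyp⟩ := hcon y hy
    simp only [Set.Finite.coe_toFinset, Set.mem_iUnion]
    exact ⟨p, hp, hyp⟩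
  obtain ⟨p, hp, hQp⟩ := (Ideal.subset_union_prime (f := fun p : Ideal R => p) ⊥ ⊥
    (fun p hp _ _ => by simpa using ((Set.Finite.mem_toFinset _).mp hp).1.1)).mp hsub
  exact h p ((Set.Finite.mem_toFinset _).mp hp) hQp

/-- If `dim R/I ≤ t`, then `ℓ(R/(I + Qⁿ))` grows at most like `n ^ t`. -/
theorem exists_length_quotient_le [IsNoetherianRing R] [IsLocalRing R] {Q : Ideal R}
    (hQ : Q.radical = IsLocalRing.maximalIdeal R) (t : ℕ) : ∀ I : Ideal R,
    ringKrullDim (R ⧸ I) ≤ t → ∃ C : ℕ, ∀ n,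
      Module.length R (R ⧸ I ⊔ Q ^ n) ≤ (C * (n + t).choose t : ℕ) := by
  have zero : ∀ I : Ideal R, Ring.KrullDimLE 0 (R ⧸ I) → ∃ C : ℕ, ∀ n,
      Module.length R (R ⧸ I ⊔ Q ^ n) ≤ (C : ℕ) := by
    intro I hI
    have : IsArtinianRing (R ⧸ I) := IsNoetherianRing.isArtinianRing_of_krullDimLE_zero
    have hfin : Module.length R (R ⧸ I) ≠ ⊤ := by
      rw [Module.length_eq_of_surjective (R := R ⧸ I) (S := R) (M := R ⧸ I)
        (Ideal.Quotient.mk_surjective)]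
      exact Module.length_ne_top
    refine ⟨(Module.length R (R ⧸ I)).toNat, fun n => ?_⟩
    rw [ENat.natCast_toNat hfin]
    exact length_quotient_mono le_sup_left
  induction t with
  | zero =>
    intro I hI
    obtain ⟨C, hC⟩ := zero I (Ring.krullDimLE_iff.mpr hI)
    exact ⟨C, fun n => by simpa using hC n⟩
  | succ t ih =>
    intro I hI
    by_cases h : ∀ p ∈ I.minimalPrimes, ¬ Q ≤ p
    · obtain ⟨y, hyQ, hy⟩ := exists_mem_forall_minimalPrimes_notMem h
      have hdim := (ringKrullDim_quotient_sup_span_singleton_succ_le hy).trans hI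
      push_cast at hdim
      obtain ⟨C, hC⟩ := ih (I ⊔ Ideal.span {y})
        (WithBot.le_natCast_of_add_one_le hdim)
      refine ⟨C, fun n => ?_⟩
      induction n with
      | zero => simp
      | succ n ihn =>
        -- Since `y Qⁿ ⊆ Qⁿ⁺¹`, the colon term is bounded by the value at `n`; the other term has
        -- smaller dimension. Pascal's rule sums the resulting recursion.
        have h1 : Module.length R (R ⧸ Submodule.comap (LinearMap.mulLeft R y) (I ⊔ Q ^ (n + 1))) ≤
            Module.length R (R ⧸ I ⊔ Q ^ n) := by
          refine length_quotient_mono (sup_le ?_ ?_)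
          · exact fun r hr => Ideal.mem_sup_left (I.mul_mem_left y hr)
          · intro r hr
            refine Ideal.mem_sup_right ?_
            rw [pow_succ']
            exact Ideal.mul_mem_mul hyQ hr
        have h2 : Ideal.span {y} ⊔ (I ⊔ Q ^ (n + 1)) = I ⊔ Ideal.span {y} ⊔ Q ^ (n + 1) := by
          rw [← sup_assoc, sup_comm (Ideal.span {y})]
        rw [length_quotient_eq_add _ y, h2]
        refine (add_le_add (h1.trans ihn) (hC (n + 1))).trans (le_of_eq ?_)
        have e1 : n + 1 + (t + 1) = (n + 1 + t) + 1 := by omega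
        have e2 : n + (t + 1) = n + 1 + t := by omega
        rw [e1, e2, Nat.choose_succ_succ]
        push_cast
        ring
    -- If `Q` lies in a minimal prime of `I`, that prime is the maximal ideal, hence the only prime
    -- over `I`, and `R/I` is Artinian.
    · push Not at h
      obtain ⟨p, hp, hQp⟩ := h
      have hmax : p = IsLocalRing.maximalIdeal R :=
        le_antisymm (IsLocalRing.le_maximalIdeal hp.1.1.ne_top)
          (hQ ▸ hp.1.1.radical_le_iff.mpr hQp)
      have : Ring.KrullDimLE 0 (R ⧸ I) := by
        rw [Ideal.krullDimLE_zero_quotient_iff_forall_minimalPrimes_isMaximal]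
        intro q hq
        have hqp : q ≤ p := hmax ▸ IsLocalRing.le_maximalIdeal hq.1.1.ne_top
        have : q = p := le_antisymm hqp (hp.2 hq.1 hqp)
        rw [this, hmax]
        infer_instance
      obtain ⟨C, hC⟩ := zero I this
      refine ⟨C, fun n => (hC n).trans ?_⟩
      exact_mod_cast Nat.le_mul_of_pos_right C (Nat.choose_pos (by omega))

/-- A form of the Artin-Rees lemma for a single element. -/
theorem exists_forall_smul_mem_pow [IsNoetherianRing R] {M : Type*} [AddCommGroup M] [Module R M]
    [Module.Finite R M] (Q : Ideal R) (u : M) : ∃ c, ∀ n, ∀ r : R,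
      r • u ∈ Q ^ n • (⊤ : Submodule R M) → ∃ q ∈ Q ^ (n - c), (r - q) • u = 0 := by
  obtain ⟨c, hc⟩ := Ideal.exists_pow_inf_eq_pow_smul Q (Submodule.span R {u})
  refine ⟨c, fun n r hr => ?_⟩
  rcases lt_or_ge n c with hn | hn
  -- For `n < c` the truncated exponent is `0`, so `q = r` is allowed.
  · exact ⟨r, by simp [Nat.sub_eq_zero_of_le hn.le], by simp⟩
  · have h1 : r • u ∈ Q ^ n • (⊤ : Submodule R M) ⊓ Submodule.span R {u} :=
      ⟨hr, Submodule.smul_mem _ _ (Submodule.mem_span_singleton_self u)⟩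
    rw [hc n hn] at h1
    have h2 := Submodule.smul_mono le_rfl inf_le_right h1
    obtain ⟨q, hq, hqu⟩ := Submodule.mem_smul_span_singleton.mp h2
    exact ⟨q, hq, by rw [sub_smul, hqu, sub_self]⟩

/-- The image of `y` is a nonzerodivisor in the domain `R/p`, so the element `r - q` that Artin-Rees
provides, which kills it, lies in `p`. -/
theorem exists_forall_comap_mulLeft_le [IsNoetherianRing R] (Q : Ideal R) (p : Ideal R)
    [p.IsPrime] {y : R} (hy : y ∉ p) : ∃ c, ∀ n,
      Submodule.comap (LinearMap.mulLeft R y) (p ⊔ Q ^ n) ≤ p ⊔ Q ^ (n - c) := by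
  obtain ⟨c, hc⟩ := exists_forall_smul_mem_pow Q (Ideal.Quotient.mk p y)
  refine ⟨c, fun n r hr => ?_⟩
  have hr' : r • Ideal.Quotient.mk p y ∈ Q ^ n • (⊤ : Submodule R (R ⧸ p)) := by
    obtain ⟨a, ha, b, hb, hab⟩ := Submodule.mem_sup.mp hr
    have : r • Ideal.Quotient.mk p y = b • (1 : R ⧸ p) := by
      rw [Algebra.smul_def, Algebra.smul_def, mul_one, Ideal.Quotient.algebraMap_eq, ← map_mul,
        Ideal.Quotient.eq]
      have : r * y - b = a := by
        rw [LinearMap.mulLeft_apply] at hab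
        linear_combination -hab
      rwa [this]
    rw [this]
    exact Submodule.smul_mem_smul hb trivial
  obtain ⟨q, hq, hqy⟩ := hc n r hr'
  rw [Algebra.smul_def, Ideal.Quotient.algebraMap_eq, ← map_mul, Ideal.Quotient.eq_zero_iff_mem] at hqy
  have := (Ideal.IsPrime.mem_or_mem ‹p.IsPrime› hqy).resolve_right hy
  exact Submodule.mem_sup.mpr ⟨r - q, this, q, hq, by ring⟩

/-- If `dim R/p ≥ t`, then `ℓ(R/(p + Qⁿ))` grows at least like `n ^ t`. -/
theorem exists_choose_le_length_quotient [IsNoetherianRing R] {Q : Ideal R}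
    (hQ : ∀ p : PrimeSpectrum R, p.asIdeal ⊔ Q ≠ ⊤) (t : ℕ) : ∀ p : PrimeSpectrum R,
    t ≤ Order.coheight p → ∃ c, 0 < c ∧ ∀ n,
      ((n.choose t : ℕ) : ℕ∞) ≤ Module.length R (R ⧸ p.asIdeal ⊔ Q ^ (c * (n + 1))) := by
  induction t with
  | zero =>
    intro p _
    refine ⟨1, one_pos, fun n => ?_⟩
    have hne : p.asIdeal ⊔ Q ^ (1 * (n + 1)) ≠ ⊤ := fun h => hQ p <| by
      rw [eq_top_iff, ← h]
      exact sup_le_sup_left (Ideal.pow_le_self (by omega)) _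
    have : Nontrivial (R ⧸ p.asIdeal ⊔ Q ^ (1 * (n + 1))) := Ideal.Quotient.nontrivial_iff.mpr hne
    simpa [Order.one_le_iff_pos] using
      Module.length_pos (R := R) (M := R ⧸ p.asIdeal ⊔ Q ^ (1 * (n + 1)))
  | succ t ih =>
    intro p hp
    obtain ⟨p₁, hlt, hp₁⟩ : ∃ p₁ > p, (t : ℕ∞) ≤ Order.coheight p₁ := by
      obtain ⟨s, hs, hlen⟩ := Order.exists_series_of_le_coheight p hp
      have : NeZero s.length := ⟨by omega⟩
      refine ⟨s 1, ?_, ?_⟩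
      · rw [← hs]
        exact s.strictMono (by simp)
      · have := Order.rev_index_le_coheight s 1
        refine le_trans ?_ this
        simp [hlen]
    -- With `y` in `p₁` but not in `p`, the cokernel term is bounded below by `R/p₁`, and the colon
    -- term by `R/p` with the exponent lowered by the constant `c₂`.
    obtain ⟨y, hyp₁, hyp⟩ := SetLike.exists_of_lt (show p.asIdeal < p₁.asIdeal from hlt)
    obtain ⟨c₁, hc₁, h₁⟩ := ih p₁ hp₁
    obtain ⟨c₂, h₂⟩ := exists_forall_comap_mulLeft_le Q p.asIdeal hyp
    have hrec : ∀ n, Module.length R (R ⧸ p.asIdeal ⊔ Q ^ (n - c₂)) +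
        Module.length R (R ⧸ p₁.asIdeal ⊔ Q ^ n) ≤ Module.length R (R ⧸ p.asIdeal ⊔ Q ^ n) := by
      intro n
      rw [length_quotient_eq_add (p.asIdeal ⊔ Q ^ n) y]
      refine add_le_add (length_quotient_mono (h₂ n)) (length_quotient_mono ?_)
      refine sup_le ?_ (sup_le_sup_right hlt.le _)
      rw [Ideal.span_singleton_le_iff_mem]
      exact Ideal.mem_sup_left hyp₁
    have hmono : ∀ (q : PrimeSpectrum R) {m n : ℕ}, m ≤ n →
        Module.length R (R ⧸ q.asIdeal ⊔ Q ^ m) ≤ Module.length R (R ⧸ q.asIdeal ⊔ Q ^ n) :=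
      fun q m n h => length_quotient_mono (sup_le_sup_left (Ideal.pow_le_pow_right h) _)
    -- One step in `n` raises the exponent by `c₁ + c₂`, which absorbs the loss `c₂` and stays above
    -- the exponent that `p₁` needs; Pascal's rule does the rest.
    refine ⟨c₁ + c₂, by omega, fun n => ?_⟩
    induction n with
    | zero => simp
    | succ n ihn =>
      refine le_trans ?_ (hrec _)
      rw [Nat.choose_succ_succ, add_comm (n.choose t)]
      push_cast
      refine add_le_add (ihn.trans (hmono p ?_)) ((h₁ n).trans (hmono p₁ ?_))
      · rw [Nat.mul_add _ (n + 1) 1]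
        omega
      · exact Nat.mul_le_mul (by omega) (by omega)

end Growth

/-! ### Reading coefficients of a polynomial from its growth. -/

section PolynomialGrowth

open Filter Topology

/-- The polynomial `∑_{j ≤ D} c_j binom(X+j-1, j)`. -/
noncomputable def chooseSum (D : ℕ) (c : ℕ → ℤ) : Polynomial ℚ :=
  ∑ j ∈ Finset.range (D + 1), Polynomial.C ((c j : ℚ) / j.factorial) * ascPochhammer ℚ j

theorem chooseSum_eval (D : ℕ) (c : ℕ → ℤ) (n : ℕ) : (chooseSum D c).eval (n : ℚ) =
    ((∑ j ∈ Finset.range (D + 1), c j * ((n + j - 1).choose j : ℤ) : ℤ) : ℚ) := by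
  rw [chooseSum, Polynomial.eval_finsetSum, Int.cast_sum]
  refine Finset.sum_congr rfl fun j _ => ?_
  rw [Polynomial.eval_mul, Polynomial.eval_C, ← ascPochhammer_eval_cast,
    ascPochhammer_nat_eq_ascFactorial, Nat.ascFactorial_eq_factorial_mul_choose']
  have := Nat.cast_ne_zero (R := ℚ).mpr j.factorial_ne_zero
  push_cast
  field_simp

theorem natDegree_chooseSum_le (D : ℕ) (c : ℕ → ℤ) : (chooseSum D c).natDegree ≤ D := by
  refine Polynomial.natDegree_sum_le_of_forall_le _ _ fun j hj => ?_
  refine (Polynomial.natDegree_C_mul_le _ _).trans ?_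
  rw [ascPochhammer_natDegree]
  simpa [Nat.lt_succ_iff] using hj

theorem coeff_chooseSum (D : ℕ) (c : ℕ → ℤ) :
    (chooseSum D c).coeff D = (c D : ℚ) / D.factorial := by
  rw [chooseSum, Polynomial.finsetSum_coeff, Finset.sum_range_succ, Finset.sum_eq_zero, zero_add,
    Polynomial.coeff_C_mul]
  · have := (monic_ascPochhammer ℚ D).coeff_natDegree
    rw [ascPochhammer_natDegree] at this
    rw [this, mul_one]
  · intro j hj
    rw [Polynomial.coeff_C_mul, Polynomial.coeff_eq_zero_of_natDegree_lt, mul_zero]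
    rw [ascPochhammer_natDegree]
    simpa using hj

theorem Polynomial.tendsto_eval_div_pow {P : Polynomial ℚ} {D : ℕ} (hP : P.natDegree ≤ D) :
    Tendsto (fun n : ℕ => P.eval (n : ℚ) / (n : ℚ) ^ D) atTop (𝓝 (P.coeff D)) := by
  have key : Tendsto (fun x : ℚ => P.eval x / (Polynomial.X ^ D : Polynomial ℚ).eval x) atTop
      (𝓝 (P.coeff D)) := by
    rcases (Polynomial.degree_le_of_natDegree_le hP).lt_or_eq with h | h
    · rw [Polynomial.coeff_eq_zero_of_degree_lt h]
      exact Polynomial.div_tendsto_atTop_zero_of_degree_lt _ _ (by simpa using h)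
    · have := Polynomial.div_tendsto_atTop_leadingCoeff_div_of_degree_eq P (Polynomial.X ^ D)
        (by simpa using h)
      rwa [Polynomial.leadingCoeff_X_pow, div_one, Polynomial.leadingCoeff,
        Polynomial.natDegree_eq_of_degree_eq_some h] at this
  exact (key.comp tendsto_natCast_atTop_atTop).congr fun n => by simp

/-- A polynomial of degree at most `D` growing at most like `n ^ t`, `t < D`, has degree
less than `D`. -/
theorem Polynomial.coeff_eq_zero_of_growth_le {P : Polynomial ℚ} {D t C : ℕ} (hP : P.natDegree ≤ D)
    (ht : t < D) (h0 : ∀ᶠ n : ℕ in atTop, 0 ≤ P.eval (n : ℚ))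
    (h : ∀ᶠ n : ℕ in atTop, P.eval (n : ℚ) ≤ (C * (n + 1 + t).choose t : ℕ)) : P.coeff D = 0 := by
  suffices h' : Tendsto (fun n : ℕ => P.eval (n : ℚ) / (n : ℚ) ^ D) atTop (𝓝 0) from
    tendsto_nhds_unique (tendsto_eval_div_pow hP) h'
  -- For `n ≥ 1`, `binom(n+1+t, t) ≤ (n+1+t)^t ≤ ((t+2)n)^t`, and one power of `n` is left over
  -- because `t < D`.
  have hlim : Tendsto (fun n : ℕ => ((C * (t + 2) ^ t : ℕ) : ℚ) / (n : ℚ)) atTop (𝓝 0) :=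
    tendsto_const_nhds.div_atTop tendsto_natCast_atTop_atTop
  refine tendsto_of_tendsto_of_tendsto_of_le_of_le' tendsto_const_nhds hlim
    (h0.mono fun n hn => div_nonneg hn (by positivity)) ?_
  filter_upwards [h, eventually_ge_atTop 1] with n hn hn1
  have hn' : (0 : ℚ) < n := by exact_mod_cast hn1
  rw [div_le_div_iff₀ (by positivity) hn']
  have h1 : C * (n + 1 + t).choose t * n ≤ C * (t + 2) ^ t * n ^ D := by
    have h2 : (n + 1 + t).choose t ≤ (t + 2) ^ t * n ^ t := by
      rw [← mul_pow]
      refine (Nat.choose_le_pow _ _).trans (Nat.pow_le_pow_left ?_ t)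
      nlinarith
    calc C * (n + 1 + t).choose t * n ≤ C * ((t + 2) ^ t * n ^ t) * n := by gcongr
      _ = C * (t + 2) ^ t * n ^ (t + 1) := by ring
      _ ≤ C * (t + 2) ^ t * n ^ D := by
        gcongr
        exact ht
  calc P.eval (n : ℚ) * n ≤ (C * (n + 1 + t).choose t : ℕ) * n := by gcongr
    _ ≤ (C * (t + 2) ^ t : ℕ) * (n : ℚ) ^ D := by exact_mod_cast h1

/-- A polynomial of degree at most `t` growing at least like `n ^ t` along an arithmetic
progression has positive coefficient in degree `t`. -/
theorem Polynomial.coeff_pos_of_le_growth {P : Polynomial ℚ} {t c c' : ℕ} (hP : P.natDegree ≤ t)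
    (hc : 0 < c)
    (h : ∀ᶠ n : ℕ in atTop, ((n.choose t : ℕ) : ℚ) ≤ P.eval ((c * (n + 1) + c' : ℕ) : ℚ)) :
    0 < P.coeff t := by
  have hsub : Tendsto (fun m : ℕ => c * (m + t + 1) + c') atTop atTop := by
    refine tendsto_atTop_mono (fun m => ?_) tendsto_id
    change m ≤ _
    nlinarith
  let A : ℕ := c * (t + 1) + c'
  have hA : 0 < A := by positivity
  -- The limit of `P(N)/N^t` along `N = c(m+t+1)+c'` is bounded below by this constant: `N ≤ A(m+1)`
  -- and `(m+1)^t ≤ t! binom(m+t, t)`.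
  refine lt_of_lt_of_le (b := 1 / ((t.factorial : ℚ) * (A : ℚ) ^ t)) (by positivity) ?_
  refine ge_of_tendsto ((tendsto_eval_div_pow hP).comp hsub) ?_
  filter_upwards [(tendsto_add_atTop_nat t).eventually h] with m hm
  simp only [Function.comp_apply]
  have hpos : 0 < c * (m + t + 1) + c' := by positivity
  have hN : (0 : ℚ) < ((c * (m + t + 1) + c' : ℕ) : ℚ) := by exact_mod_cast hpos
  rw [div_le_div_iff₀ (by positivity) (by positivity), one_mul]
  have h1 : (c * (m + t + 1) + c') ^ t ≤ (m + t).choose t * (t.factorial * A ^ t) := by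
    have h2 := Nat.pow_sub_le_descFactorial (m + t) t
    rw [show m + t + 1 - t = m + 1 by omega, Nat.descFactorial_eq_factorial_mul_choose] at h2
    have h3 : c * (m + t + 1) + c' ≤ A * (m + 1) := by
      have : A * (m + 1) = c * (m + t + 1) + c' + (c * t + c') * m := by ring
      omega
    calc (c * (m + t + 1) + c') ^ t ≤ (A * (m + 1)) ^ t := Nat.pow_le_pow_left h3 t
      _ = A ^ t * (m + 1) ^ t := mul_pow _ _ _
      _ ≤ A ^ t * (t.factorial * (m + t).choose t) := Nat.mul_le_mul_left _ h2
      _ = (m + t).choose t * (t.factorial * A ^ t) := by ring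
  calc (((c * (m + t + 1) + c' : ℕ) : ℚ)) ^ t ≤ ((m + t).choose t : ℕ) * (t.factorial * (A : ℚ) ^ t) := by
        exact_mod_cast h1
    _ ≤ _ := by gcongr

end PolynomialGrowth

/-! ### Dimension and growth of the unmixed component. -/

section UnmixedComponent

variable {R : Type*} [CommRing R]

theorem ringKrullDim_quotient_eq_coheight (p : PrimeSpectrum R) :
    ringKrullDim (R ⧸ p.asIdeal) = Order.coheight p := by
  rw [ringKrullDim_quotient, Order.coheight_eq_krullDim_Ici]
  rfl

/-- The first prime of a long chain over `I` contains a minimal prime of `I`, whose coheight is at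
least the length of the chain. -/
theorem exists_minimalPrimes_le_coheight {I : Ideal R} {n : ℕ}
    (h : (n : WithBot ℕ∞) ≤ ringKrullDim (R ⧸ I)) :
    ∃ p : PrimeSpectrum R, p.asIdeal ∈ I.minimalPrimes ∧ n ≤ Order.coheight p := by
  rw [ringKrullDim_quotient] at h
  obtain ⟨s, hs⟩ := Order.le_krullDim_iff.mp h
  have hle : I ≤ s.head.1.asIdeal := s.head.2
  obtain ⟨p, hp, hps⟩ := Ideal.exists_minimalPrimes_le hle
  refine ⟨⟨p, hp.1.1⟩, hp, ?_⟩
  let s' : LTSeries (PrimeSpectrum R) := s.map Subtype.val (fun _ _ h => h)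
  have : (s'.length : ℕ∞) ≤ Order.coheight (⟨p, hp.1.1⟩ : PrimeSpectrum R) :=
    Order.length_le_coheight (p := s') hps
  rwa [← hs]

theorem mem_assh_of_le_coheight {d : ℕ} (hd : ringKrullDim R = d) {p : PrimeSpectrum R}
    (hp : p.asIdeal ∈ associatedPrimes R R) (h : d ≤ Order.coheight p) : p.asIdeal ∈ assh R := by
  refine ⟨hp, le_antisymm (ringKrullDim_quotient_le _) ?_⟩
  rw [ringKrullDim_quotient_eq_coheight, hd]
  exact_mod_cast h

/-- The primes in `Assh R` are minimal. -/
theorem eq_of_le_of_mem_assh {d : ℕ} (hd : ringKrullDim R = d) {p p' : Ideal R} (hp : p ∈ assh R)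
    (hp' : p'.IsPrime) (h : p' ≤ p) : p' = p := by
  by_contra hne
  let P : PrimeSpectrum R := ⟨p, hp.1.1⟩
  let P' : PrimeSpectrum R := ⟨p', hp'⟩
  have hlt : P' < P := lt_of_le_of_ne h fun e => hne (congrArg PrimeSpectrum.asIdeal e)
  have h1 : Order.coheight P + 1 ≤ Order.coheight P' := Order.coheight_add_one_le hlt
  have h2 : (Order.coheight P : WithBot ℕ∞) = d := by
    rw [← ringKrullDim_quotient_eq_coheight, ← hd]
    exact hp.2
  have h3 : (Order.coheight P' : WithBot ℕ∞) ≤ d := by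
    rw [← ringKrullDim_quotient_eq_coheight, ← hd]
    exact ringKrullDim_quotient_le _
  have h2' : Order.coheight P = d := by exact_mod_cast h2
  have h3' : Order.coheight P' ≤ d := by exact_mod_cast h3
  rw [h2'] at h1
  have := h1.trans h3'
  norm_cast at this
  omega

theorem IsUnmixedComponent.le_of_mem_assh {U : Ideal R} (hU : IsUnmixedComponent U) {p : Ideal R}
    (hp : p ∈ assh R) : U ≤ p := by
  obtain ⟨q, hq, rfl⟩ := hU
  exact (iInf₂_le p hp).trans (Ideal.le_radical.trans (hq.radical_eq p hp.1).le)

/-- The product of the components `q p'` with `p' ≠ p` kills `U`: for `r` in it and `u` in `U`, `r *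
u` lies in `q p` because of `u` and in the other components because of `r`. If `p` contained it,
some `p' ≠ p` would lie in `p`, but `p` is minimal. -/
theorem IsUnmixedComponent.not_annihilator_le [IsNoetherianRing R] {d : ℕ}
    (hd : ringKrullDim R = d) {U : Ideal R} (hU : IsUnmixedComponent U) {p : Ideal R}
    (hp : p ∈ assh R) : ¬ Module.annihilator R U ≤ p := by
  classical
  obtain ⟨q, hq, rfl⟩ := hU
  intro hle
  have hprime : p.IsPrime := hp.1.1
  let s : Finset (Ideal R) := (associatedPrimes.finite R R).toFinset.erase p
  have hs : ∏ p' ∈ s, q p' ≤ Module.annihilator R ↥(⨅ p ∈ assh R, q p) := by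
    intro r hr
    rw [Module.mem_annihilator]
    rintro ⟨u, hu⟩
    refine Subtype.ext ?_
    change r * u = 0
    rw [← Ideal.mem_bot, ← hq.iInf_eq]
    simp only [Ideal.mem_iInf] at hu ⊢
    intro p' hp'
    by_cases h : p' = p
    · subst h
      exact Ideal.mul_mem_left _ r (hu p' hp)
    · have hp's : p' ∈ s := by simp [s, h, hp']
      exact Ideal.mul_mem_right u _ (Ideal.prod_le_inf.trans (Finset.inf_le hp's) hr)
  obtain ⟨p', hp's, hp'⟩ := (Ideal.IsPrime.prod_le hprime).mp (hs.trans hle)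
  simp only [s, Finset.mem_erase, Set.Finite.mem_toFinset] at hp's
  have h1 : p' ≤ p := hq.radical_eq p' hp's.2 ▸ hprime.radical_le_iff.mpr hp'
  exact hp's.1 (eq_of_le_of_mem_assh hd hp hp's.2.1 h1)

/-- Otherwise some minimal prime of `Ann U` has coheight at least `d`. It is associated to `U`,
hence to `R`, so it is a prime of `Assh R` containing `Ann U`. -/
theorem IsUnmixedComponent.supportDim_lt [IsNoetherianRing R] {d : ℕ}
    (hd : ringKrullDim R = d) {U : Ideal R} (hU : IsUnmixedComponent U) :
    Module.supportDim R U < d := by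
  rw [Module.supportDim_eq_ringKrullDim_quotient_annihilator]
  by_contra! h
  obtain ⟨p, hp, hcoh⟩ := exists_minimalPrimes_le_coheight h
  have hpU := Module.associatedPrimes.minimalPrimes_annihilator_subset_associatedPrimes R U hp
  have hpR := IsAssociatedPrime.map_of_injective U.subtype hpU U.subtype_injective
  exact hU.not_annihilator_le hd (mem_assh_of_le_coheight hd hpR hcoh) hp.1.2

theorem IsUnmixedComponent.ringKrullDim_quotient_eq [IsNoetherianRing R] {d : ℕ}
    (hd : ringKrullDim R = d) {U : Ideal R} (hU : IsUnmixedComponent U) :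
    ringKrullDim (R ⧸ U) = d := by
  refine le_antisymm (hd ▸ ringKrullDim_quotient_le _) ?_
  -- Phrasing `dim R` through `Ann R` lets the minimal prime found be recognized as an associated
  -- prime of `R`; it is then in `Assh R` and contains `U`.
  have hd' : (d : WithBot ℕ∞) ≤ ringKrullDim (R ⧸ Module.annihilator R R) := by
    rw [← Module.supportDim_eq_ringKrullDim_quotient_annihilator,
      Module.supportDim_self_eq_ringKrullDim, hd]
  obtain ⟨p, hp, hcoh⟩ := exists_minimalPrimes_le_coheight hd'
  have hpR := Module.associatedPrimes.minimalPrimes_annihilator_subset_associatedPrimes R R hp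
  have hp := mem_assh_of_le_coheight hd hpR hcoh
  rw [← hd, ← hp.2]
  exact ringKrullDim_le_of_surjective (Ideal.Quotient.factor (hU.le_of_mem_assh hp))
    (Ideal.Quotient.factor_surjective _)

theorem relLength_sup_le {M : Type*} [AddCommGroup M] [Module R M] (b a a' : Submodule R M) :
    relLength b (a ⊔ a') ≤ relLength b a + relLength b a' := by
  rw [← relLength_sup_right b (a ⊔ a'), show a ⊔ a' ⊔ b = a' ⊔ (a ⊔ b) by ac_rfl,
    relLength_eq_add (c := a ⊔ b) le_sup_right le_sup_right, relLength_sup_right,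
    relLength_sup_right]
  exact add_le_add le_rfl (relLength_anti_left _ le_sup_right)

/-- A cyclic submodule of `U` is a quotient of `R/Ann U`, and relative length is subadditive over
sums; `k` counts generators of `U`. -/
theorem exists_relLength_le_mul [IsNoetherianRing R] (U : Ideal R) : ∃ k : ℕ, ∀ J : Ideal R,
    relLength J U ≤ k * Module.length R (R ⧸ Module.annihilator R U ⊔ J) := by
  suffices h : ∀ N : Ideal R, N.FG → N ≤ U → ∃ k : ℕ, ∀ J : Ideal R,
      relLength J N ≤ k * Module.length R (R ⧸ Module.annihilator R U ⊔ J) from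
    h U (IsNoetherian.noetherian U) le_rfl
  intro N hN
  induction N, hN using Submodule.fg_induction with
  | singleton x =>
    intro hx
    have hxU : x ∈ U := hx (Submodule.mem_span_singleton_self x)
    refine ⟨1, fun J => ?_⟩
    rw [Nat.cast_one, one_mul]
    refine (relLength_span_singleton J x).trans_le (length_quotient_mono (sup_le ?_ ?_))
    · intro r hr
      have := congrArg Subtype.val (Module.mem_annihilator.mp hr ⟨x, hxU⟩)
      change x * r ∈ J
      rw [mul_comm, show r * x = 0 from this]
      exact J.zero_mem
    · exact fun r hr => J.mul_mem_left x hr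
  | sup N₁ N₂ _ _ h₁ h₂ =>
    intro hN
    obtain ⟨k₁, hk₁⟩ := h₁ (le_sup_left.trans hN)
    obtain ⟨k₂, hk₂⟩ := h₂ (le_sup_right.trans hN)
    refine ⟨k₁ + k₂, fun J => (relLength_sup_le J N₁ N₂).trans ?_⟩
    rw [Nat.cast_add, add_mul]
    exact add_le_add (hk₁ J) (hk₂ J)

variable [IsNoetherianRing R] [IsLocalRing R] {Q K : Ideal R}

/-- `ℓ(U/(KQⁿ ∩ U))` grows at most like `n ^ t` if `dim U ≤ t`. -/
theorem exists_relLength_le (hQ : Q.radical = IsLocalRing.maximalIdeal R) (hQK : Q ≤ K)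
    {U : Ideal R} {t : ℕ} (ht : Module.supportDim R U ≤ t) : ∃ C : ℕ, ∀ n,
      relLength (K * Q ^ n) U ≤ (C * (n + 1 + t).choose t : ℕ) := by
  rw [Module.supportDim_eq_ringKrullDim_quotient_annihilator] at ht
  obtain ⟨C, hC⟩ := exists_length_quotient_le hQ t _ ht
  obtain ⟨k, hk⟩ := exists_relLength_le_mul U
  refine ⟨k * C, fun n => ?_⟩
  have hle : Q ^ (n + 1) ≤ K * Q ^ n := by
    rw [pow_succ']
    exact Ideal.mul_mono_left hQK
  refine (relLength_anti_left U hle).trans ((hk _).trans ?_)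
  rw [mul_assoc, Nat.cast_mul]
  gcongr
  exact hC (n + 1)

/-- `ℓ(U/(KQⁿ ∩ U))` grows at least like `n ^ t` if `dim U ≥ t`. -/
theorem exists_choose_le_relLength (hQ : Q.radical = IsLocalRing.maximalIdeal R)
    {U : Ideal R} {t : ℕ} (ht : t ≤ Module.supportDim R U) : ∃ c c' : ℕ, 0 < c ∧ ∀ n,
      ((n.choose t : ℕ) : ℕ∞) ≤ relLength (K * Q ^ (c * (n + 1) + c')) U := by
  rw [Module.supportDim_eq_ringKrullDim_quotient_annihilator] at ht
  obtain ⟨p, hp, hcoh⟩ := exists_minimalPrimes_le_coheight ht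
  have hpU := Module.associatedPrimes.minimalPrimes_annihilator_subset_associatedPrimes R U hp
  obtain ⟨_, u, hu⟩ := isAssociatedPrime_iff.mp hpU
  have hQm : Q ≤ IsLocalRing.maximalIdeal R := hQ ▸ Ideal.le_radical
  obtain ⟨c, hc, hlen⟩ := exists_choose_le_length_quotient (Q := Q) (fun p h =>
    (IsLocalRing.maximalIdeal.isMaximal R).ne_top <| top_le_iff.mp <| h ▸
      sup_le (IsLocalRing.le_maximalIdeal p.2.ne_top) hQm) t p hcoh
  -- Here `p` is the annihilator of `u`. Artin-Rees with shift `c'` turns `r u ∈ Q^(N+c')` into `r ∈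
  -- p + Q^N`.
  obtain ⟨c', hc'⟩ := exists_forall_smul_mem_pow Q (u : R)
  refine ⟨c, c', hc, fun n => (hlen n).trans ?_⟩
  have hspan : Ideal.span {(u : R)} ≤ U := (Ideal.span_singleton_le_iff_mem _).mpr u.2
  refine le_trans ?_ (relLength_mono_right _ hspan)
  rw [relLength_span_singleton]
  refine length_quotient_mono fun r hr => ?_
  have hr' : r • (u : R) ∈ Q ^ (c * (n + 1) + c') • (⊤ : Submodule R R) := by
    have hmem : (u : R) * r ∈ Q ^ (c * (n + 1) + c') :=
      (Ideal.mul_le_right : K * Q ^ (c * (n + 1) + c') ≤ _) hr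
    have htop : Q ^ (c * (n + 1) + c') • (⊤ : Submodule R R) = Q ^ (c * (n + 1) + c') :=
      Ideal.mul_top _
    rw [htop, smul_eq_mul, mul_comm r]
    exact hmem
  obtain ⟨q, hq, hqu⟩ := hc' _ r hr'
  rw [Nat.add_sub_cancel] at hq
  refine Submodule.mem_sup.mpr ⟨r - q, ?_, q, hq, by ring⟩
  rw [hu, Submodule.mem_colon_singleton, Submodule.mem_bot]
  exact Subtype.ext hqu

end UnmixedComponent

/-! ### Comparison of the Hilbert coefficients. -/

section Main

open Filter

variable {R : Type*} [CommRing R]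

theorem eventually_relLength_eq_sum {e : ℕ} (hd : ringKrullDim R = (e + 1 : ℕ)) {Q K U : Ideal R}
    (hdU : ringKrullDim (R ⧸ U) = (e + 1 : ℕ)) {g g' : ℕ → ℤ} (hg : HasHilbertCoeffs Q K g)
    (hg' : HasHilbertCoeffs (Q.map (Ideal.Quotient.mk U)) (K.map (Ideal.Quotient.mk U)) g') :
    ∀ᶠ n : ℕ in atTop, ∃ m : ℕ, relLength (K * Q ^ n) U = m ∧
      (m : ℤ) = ∑ j ∈ Finset.range (e + 1 + 1),
        (-1) ^ (e + 1 - j) * (g (e + 1 - j) - g' (e + 1 - j)) * ((n + j - 1).choose j : ℤ) := by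
  obtain ⟨d, hd₁, -, h⟩ := hg
  obtain ⟨d', hd₁', -, h'⟩ := hg'
  obtain rfl : e + 1 = d := by rw [hd] at hd₁; exact_mod_cast hd₁
  obtain rfl : e + 1 = d' := by rw [hdU] at hd₁'; exact_mod_cast hd₁'
  filter_upwards [h, h'] with n hn hn'
  obtain ⟨m, hm, hmg⟩ := hn
  obtain ⟨m', hm', hmg'⟩ := hn'
  rw [← Ideal.map_pow, ← Ideal.map_mul, length_quotient_map_mk] at hm'
  have hadd := length_quotient_eq_add_relLength U (K * Q ^ n)
  rw [hm, hm'] at hadd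
  obtain ⟨w, hw⟩ := ENat.ne_top_iff_exists.mp
    (ne_top_of_le_ne_top (ENat.natCast_ne_top m) (hadd ▸ le_self_add))
  rw [← hw] at hadd
  have hadd' : m = w + m' := by exact_mod_cast hadd
  refine ⟨w, hw.symm, ?_⟩
  have : (w : ℤ) = m - m' := by omega
  rw [this, hmg, hmg', ← Finset.sum_sub_distrib, ← Finset.sum_range_reflect]
  refine Finset.sum_congr rfl fun j hj => ?_
  have hj' : j ≤ e + 1 := by simpa [Nat.lt_succ_iff] using hj
  rw [show e + 1 + 1 - 1 - j = e + 1 - j by omega, Nat.sub_sub_self hj']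
  ring

/-- An upper bound of order `n ^ t` kills the coefficients above degree `t`, and a lower bound of
the same order makes the one in degree `t` positive when `t = e`. -/
theorem relLength_growth [IsNoetherianRing R] [IsLocalRing R] {Q K U : Ideal R} {e t : ℕ}
    (hQ : Q.radical = IsLocalRing.maximalIdeal R) (hQK : Q ≤ K)
    (ht : Module.supportDim R U = t) (hte : t ≤ e) {c : ℕ → ℤ}
    (h : ∀ᶠ n : ℕ in atTop, ∃ m : ℕ, relLength (K * Q ^ n) U = m ∧
      (m : ℤ) = ∑ j ∈ Finset.range (e + 1 + 1), c j * ((n + j - 1).choose j : ℤ)) :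
    c (e + 1) = 0 ∧ (t < e → c e = 0) ∧ (t = e → 0 < c e) ∧
    ∀ᶠ n : ℕ in atTop, ∃ m : ℕ, relLength (K * Q ^ n) U = m ∧
      (chooseSum e c).eval (n : ℚ) = m := by
  -- Used first for `D = e + 1` and then, once that coefficient is removed, for `D = e`.
  have hvanish : ∀ D, t < D → (∀ᶠ n : ℕ in atTop, ∃ m : ℕ, relLength (K * Q ^ n) U = m ∧
      (chooseSum D c).eval (n : ℚ) = m) → c D = 0 := by
    intro D hD hev
    obtain ⟨C, hC⟩ := exists_relLength_le hQ hQK ht.le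
    have := Polynomial.coeff_eq_zero_of_growth_le (natDegree_chooseSum_le D c) hD
      (hev.mono fun n ⟨m, _, hm⟩ => hm ▸ Nat.cast_nonneg m)
      (hev.mono fun n ⟨m, hmr, hm⟩ => by
        have := hC n
        rw [hmr] at this
        rw [hm]
        exact_mod_cast this)
    rw [coeff_chooseSum, div_eq_zero_iff] at this
    exact_mod_cast this.resolve_right (Nat.cast_ne_zero.mpr D.factorial_ne_zero)
  have h0 : c (e + 1) = 0 := by
    refine hvanish (e + 1) (by omega) (h.mono fun n ⟨m, hmr, hm⟩ => ⟨m, hmr, ?_⟩)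
    rw [chooseSum_eval, ← hm, Int.cast_natCast]
  have hev : ∀ᶠ n : ℕ in atTop, ∃ m : ℕ, relLength (K * Q ^ n) U = m ∧
      (chooseSum e c).eval (n : ℚ) = m := by
    refine h.mono fun n ⟨m, hmr, hm⟩ => ⟨m, hmr, ?_⟩
    rw [Finset.sum_range_succ, h0, zero_mul, add_zero] at hm
    rw [chooseSum_eval, ← hm, Int.cast_natCast]
  refine ⟨h0, fun hlt => hvanish e hlt hev, ?_, hev⟩
  rintro rfl
  obtain ⟨a, b, ha, hab⟩ := exists_choose_le_relLength (K := K) hQ ht.ge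
  have htend : Tendsto (fun n : ℕ => a * (n + 1) + b) atTop atTop := by
    refine tendsto_atTop_mono (fun m => ?_) tendsto_id
    change m ≤ _
    nlinarith
  have := Polynomial.coeff_pos_of_le_growth (natDegree_chooseSum_le t c) ha (c' := b)
    ((htend.eventually hev).mono fun n ⟨m, hmr, hm⟩ => by
      have := hab n
      rw [hmr] at this
      rw [hm]
      exact_mod_cast this)
  rw [coeff_chooseSum, lt_div_iff₀ (by exact_mod_cast t.factorial_pos), zero_mul] at this
  exact_mod_cast this

/-- The exponent `n + 1` replaces the polynomial by its composite with `X + 1`, which keeps the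
degree `e` and the leading coefficient `c e / e!`. -/
theorem hasMultiplicity_of_eventually {Q K U : Ideal R} {e : ℕ} {c : ℕ → ℤ} (hc : c e ≠ 0)
    (h : ∀ᶠ n : ℕ in atTop, ∃ m : ℕ, relLength (K * Q ^ n) U = m ∧
      (chooseSum e c).eval (n : ℚ) = m) :
    HasMultiplicity R (fun n : ℕ => U ⧸ (Submodule.comap (Submodule.subtype U) (K * Q ^ (n + 1))))
      (c e) := by
  have hcoeff : (chooseSum e c).coeff e ≠ 0 := by
    rw [coeff_chooseSum]
    exact div_ne_zero (by exact_mod_cast hc) (Nat.cast_ne_zero.mpr e.factorial_ne_zero)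
  have hdeg : (chooseSum e c).natDegree = e :=
    Polynomial.natDegree_eq_of_le_of_coeff_ne_zero (natDegree_chooseSum_le e c) hcoeff
  have hX : (Polynomial.X + 1 : Polynomial ℚ).natDegree = 1 := Polynomial.natDegree_X_add_C 1
  have hlead : ((chooseSum e c).comp (Polynomial.X + 1)).leadingCoeff = c e / e.factorial := by
    rw [Polynomial.leadingCoeff_comp (by rw [hX]; exact one_ne_zero),
      show (Polynomial.X + 1 : Polynomial ℚ).leadingCoeff = 1 from Polynomial.leadingCoeff_X_add_C 1,
      one_pow, mul_one, Polynomial.leadingCoeff, hdeg, coeff_chooseSum]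
  refine ⟨(chooseSum e c).comp (Polynomial.X + 1), ?_, ?_, ?_⟩
  · rw [← Polynomial.leadingCoeff_ne_zero, hlead, ← coeff_chooseSum]
    exact hcoeff
  · refine ((tendsto_add_atTop_nat 1).eventually h).mono fun n ⟨m, hmr, hm⟩ => ⟨m, hmr, ?_⟩
    rw [← hm]
    simp
  · rw [Polynomial.natDegree_comp, hX, mul_one, hlead, hdeg, mul_div_cancel₀]
    exact Nat.cast_ne_zero.mpr e.factorial_ne_zero

theorem exists_hasHilbertCoeffs [IsNoetherianRing R] {d : ℕ} (hd : ringKrullDim R = d)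
    {Q K : Ideal R} (x : Fin d → R) (hx : Q = Ideal.span (Set.range x))
    (hfin : ∀ n, Module.length R (R ⧸ K * Q ^ n) ≠ ⊤) : ∃ g : ℕ → ℤ, HasHilbertCoeffs Q K g :=
  HasHilbertCoeffs.of_eventuallyPolynomial hd hfin (eventuallyPolynomial_length_quotient x hx K hfin)

end Main

theorem mainTheorem9 {R : Type*} [CommRing R] [IsLocalRing R] [IsNoetherianRing R]
    (d : ℕ) (hd : ringKrullDim R = d) (hd0 : 0 < d)
    (Q K : Ideal R) (hQ : IsParameterIdeal Q) (hQK : Q ≤ K)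
    (U : Ideal R) (hU : IsUnmixedComponent U) (hU0 : U ≠ ⊥) :
    -- `S = R ⧸ U`; the Hilbert coefficients of `Q` and of `QS` (with respect to `K`, `KS`) exist
    HasHilbertCoeffs Q K (hilbertCoeff Q K) ∧
    HasHilbertCoeffs (Q.map (Ideal.Quotient.mk U)) (K.map (Ideal.Quotient.mk U))
      (hilbertCoeff (Q.map (Ideal.Quotient.mk U)) (K.map (Ideal.Quotient.mk U))) ∧
    -- (a)
    Module.supportDim R U < ringKrullDim R ∧
    -- (b)
    hilbertCoeff Q K 0 =
      hilbertCoeff (Q.map (Ideal.Quotient.mk U)) (K.map (Ideal.Quotient.mk U)) 0 ∧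
    (Module.supportDim R U + 2 ≤ d →
      hilbertCoeff Q K 1 =
        hilbertCoeff (Q.map (Ideal.Quotient.mk U)) (K.map (Ideal.Quotient.mk U)) 1) ∧
    (Module.supportDim R U + 1 = d →
      ∃ s₀ : ℤ,
        HasMultiplicity R
          (fun n : ℕ => U ⧸ (Submodule.comap (Submodule.subtype U) (K * Q ^ (n + 1)))) s₀ ∧
        hilbertCoeff Q K 1 =
          hilbertCoeff (Q.map (Ideal.Quotient.mk U)) (K.map (Ideal.Quotient.mk U)) 1 - s₀) ∧
    -- (c)
    hilbertCoeff Q K 1 ≤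
      hilbertCoeff (Q.map (Ideal.Quotient.mk U)) (K.map (Ideal.Quotient.mk U)) 1 ∧
    (hilbertCoeff Q K 1 =
        hilbertCoeff (Q.map (Ideal.Quotient.mk U)) (K.map (Ideal.Quotient.mk U)) 1 ↔
      Module.supportDim R U + 2 ≤ d) := by
  obtain ⟨e, rfl⟩ : ∃ e, d = e + 1 := ⟨d - 1, by omega⟩
  obtain ⟨d', x, hd', hx, hQrad⟩ := hQ
  obtain rfl : e + 1 = d' := by rw [hd] at hd'; exact_mod_cast hd'
  have hfin : ∀ n, Module.length R (R ⧸ K * Q ^ n) ≠ ⊤ := fun n =>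
    length_quotient_ne_top (hQrad ▸ IsLocalRing.maximalIdeal.isMaximal R) (n := n + 1)
      (pow_succ' Q n ▸ Ideal.mul_mono_left hQK)
  have hdU := hU.ringKrullDim_quotient_eq hd
  have hg := hasHilbertCoeffs_hilbertCoeff (exists_hasHilbertCoeffs hd x hx hfin)
  have hg' := hasHilbertCoeffs_hilbertCoeff (exists_hasHilbertCoeffs hdU
    (Q := Q.map (Ideal.Quotient.mk U)) (K := K.map (Ideal.Quotient.mk U))
    (fun i => Ideal.Quotient.mk U (x i))
    (by rw [hx, Ideal.map_span, ← Set.range_comp]; rfl) (fun n => by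
      rw [← Ideal.map_pow, ← Ideal.map_mul, length_quotient_map_mk]
      exact ne_top_of_le_ne_top (hfin n) (length_quotient_mono le_sup_right)))
  have hlt := hU.supportDim_lt hd
  -- `U ≠ 0` excludes the dimension `⊥`, so that `dim U` is a natural number.
  have hne : Module.supportDim R U ≠ ⊥ := by
    rw [Module.supportDim_ne_bot_iff_nontrivial]
    exact Submodule.nontrivial_iff_ne_bot.mpr hU0
  obtain ⟨t, ht⟩ : ∃ t : ℕ, Module.supportDim R U = t := by
    generalize Module.supportDim R U = s at hlt hne
    cases s with
    | bot => exact absurd rfl hne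
    | coe s =>
      have hs : s < ((e + 1 : ℕ) : ℕ∞) := by exact_mod_cast hlt
      lift s to ℕ using hs.ne_top
      exact ⟨s, rfl⟩
  have hte : t ≤ e := by
    rw [ht] at hlt
    have : t < e + 1 := by exact_mod_cast hlt
    omega
  obtain ⟨h0, h1, h2, hev⟩ := relLength_growth hQrad hQK ht hte
    (eventually_relLength_eq_sum hd hdU hg hg')
  have e1 : e + 1 - e = 1 := by omega
  -- The coefficients now read `g₀(Q) - g₀(QS)` in degree `e + 1` and `-(g₁(Q) - g₁(QS))` in degree
  -- `e`; the latter is `s₀` when `t = e`.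
  simp only [e1, Nat.sub_self, pow_zero, pow_one, one_mul] at h0 h1 h2
  have hiff : Module.supportDim R U + 2 ≤ ((e + 1 : ℕ) : WithBot ℕ∞) ↔ t < e := by
    rw [ht]
    norm_cast
    omega
  have hiff' : Module.supportDim R U + 1 = ((e + 1 : ℕ) : WithBot ℕ∞) ↔ t = e := by
    rw [ht]
    norm_cast
    omega
  refine ⟨hg, hg', hd ▸ hlt, by omega, fun h => ?_, fun h => ?_, ?_, ?_⟩
  · have := h1 (hiff.mp h)
    omega
  · have h3 := h2 (hiff'.mp h)
    refine ⟨_, hasMultiplicity_of_eventually ?_ hev, ?_⟩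
    · simp only [e1, pow_one]
      omega
    · simp only [e1, pow_one]
      omega
  · rcases hte.lt_or_eq with h | h
    · have := h1 h
      omega
    · have := h2 h
      omega
  · rw [hiff]
    refine ⟨fun h => ?_, fun h => ?_⟩
    · by_contra hcon
      have := h2 (by omega)
      omega
    · have := h1 h
      omega
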